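/- For $k\ge 1$ and an integer $\beta\ge 2(k+1)$, the cluster tree skeleton $CT_k$ is the following finite rooted tree, whose vertices are called clusters and whose edges are labeled. An edge labeled $\{(C,x),(C',y)\}$ joins $C$ and $C'$, and we say that $C$ is connected to $C'$ via outgoing label $x$, and $C'$ to $C$ via outgoing label $y$. The tree $CT_1$ has root $C_0$, further clusters $C_1,C_2,C_3$, and the edges $\{(C_0,\beta^0),(C_1,\beta^1)\}$, $\{(C_0,\beta^1),(C_2,\beta^2)\}$, $\{(C_1,\beta^0),(C_3,\beta^1)\}$. For $k\ge 2$, $CT_k$ arises from $CT_{k-1}$ by attaching 1. to each internal (non-leaf) cluster $C$ of $CT_{k-1}$ one new cluster $C'$ via an edge $\{(C,\beta^k),(C',\beta^{k+1})\}$; 2. to each leaf cluster $C$ of $CT_{k-1}$, connected to its parent via outgoing label $\beta^q$, one new cluster $C'$ via an edge $\{(C,\beta^p),(C',\beta^{p+1})\}$ for each $p\in\{0,\dots,k\}\setminus\{q\}$. A CT graph $G_k$ (with parameter $\beta$) is a finite simple graph whose node set is partitioned into nonempty independent sets, one for each cluster of $CT_k$, such that for every edge $\{(C,x),(C',y)\}$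 of $CT_k$ each node in $C$ has exactly $x$ neighbors in $C'$ and each node in $C'$ has exactly $y$ neighbors in $C$, and such that there are no edges between clusters that are not adjacent in $CT_k$. **Theorem (Existence of $G_k$).** There is an absolute constant $A$ such that for all integers $k\ge 1$ and $\beta\ge 2(k+1)$ there exists a CT graph $G_k$ with parameter $\beta$ that has girth at least $2k+1$ and at most $A\,\beta^{2k^2+4k+1}$ nodes. -/

import Mathlib

namespace ClusterTree

/-- Clusters of the skeletons are named by the way they are reached from the root `C₀ = []`:
`x :: C` is the child of `C` that is attached to `C` by the edge labelled
`{(C, β ^ x), (x :: C, β ^ (x + 1))}`. (All edges of all skeletons have labels of this shape, and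
the exponents `x` at the children of one cluster are distinct.) So `[]`, `[0]`, `[1]`, `[0, 0]` are
`C₀`, `C₁`, `C₂`, `C₃`, the parent of `x :: C` is `C`, and the level of a cluster is its length. -/
abbrev Cluster : Type := List ℕ

/-- `C` is internal in the skeleton with set of clusters `S`: it has a child in `S`. -/
def IsInternal (S : Finset Cluster) (C : Cluster) : Prop :=
  ∃ D ∈ S, D ≠ [] ∧ D.tail = C

instance (S : Finset Cluster) : DecidablePred (IsInternal S) := fun C =>
  inferInstanceAs (Decidable (∃ D ∈ S, D ≠ [] ∧ D.tail = C))

/-- The exponent `q` such that `C` is connected to its parent via outgoing label `β ^ q`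
(`none` for the root). -/
def parentExponent (C : Cluster) : Option ℕ :=
  C.head?.map (· + 1)

/-- The set of clusters obtained by applying step `k` of the growth rules to the skeleton with set
of clusters `S`: every internal cluster `C` gets one new child via outgoing label `β ^ k`,
every leaf cluster `C` gets new children via outgoing labels `β ^ p` for all `p ≤ k` except the
exponent of the label of `C` towards its parent. -/
def grow (k : ℕ) (S : Finset Cluster) : Finset Cluster :=
  S ∪ (S.filter fun C => IsInternal S C).image (fun C => k :: C) ∪
    (S.filter fun C => ¬ IsInternal S C).biUnion fun C =>
      ((Finset.range (k + 1)).filter fun p => parentExponent C ≠ some p).image fun p => p :: C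

/-- The clusters of the cluster tree skeleton `CT_k`, for `k ≥ 1` (the value at `0` is unused). -/
def skeleton : ℕ → Finset Cluster
  | 0 => ∅
  | 1 => {[], [0], [1], [0, 0]}
  | k + 2 => grow (k + 2) (skeleton (k + 1))

/-- `c` exhibits `G` as a CT graph for the skeleton `CT_k` with parameter `β`, where `c v` is the
cluster to which the node `v` belongs. -/
structure IsClustering {V : Type*} (k β : ℕ) (G : SimpleGraph V) (c : V → Cluster) : Prop where
  /-- Every node belongs to a cluster of `CT_k`. -/
  mem : ∀ v, c v ∈ skeleton k
  /-- Every cluster of `CT_k` has nodes. -/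
  nonempty : ∀ C ∈ skeleton k, ∃ v, c v = C
  /-- Edges only run between clusters joined by an edge of `CT_k`; in particular, every cluster is
  an independent set. -/
  adj : ∀ v w, G.Adj v w → ∃ x, c w = x :: c v ∨ c v = x :: c w
  /-- Along an edge `{(C, β ^ x), (x :: C, β ^ (x + 1))}` of `CT_k`, nodes in `C` have `β ^ x`
  neighbors in `x :: C`. -/
  down : ∀ (x : ℕ) (C : Cluster), x :: C ∈ skeleton k → ∀ v, c v = C →
    {w | G.Adj v w ∧ c w = x :: C}.ncard = β ^ x
  /-- Along an edge `{(C, β ^ x), (x :: C, β ^ (x + 1))}` of `CT_k`, nodes in `x :: C` have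
  `β ^ (x + 1)` neighbors in `C`. -/
  up : ∀ (x : ℕ) (C : Cluster), x :: C ∈ skeleton k → ∀ w, c w = x :: C →
    {v | G.Adj w v ∧ c v = C}.ncard = β ^ (x + 1)

/-- `G` is a CT graph `G_k` with parameter `β`. -/
def IsCTGraph {V : Type*} (k β : ℕ) (G : SimpleGraph V) : Prop :=
  ∃ c : V → Cluster, IsClustering k β G c

end ClusterTree

/-!
The graph is found by edge switching. A CT graph without any girth condition is easy to write down:
cut neighboring clusters into blocks and join corresponding blocks completely (`blockGraph`). If
`uv` and `u'v'` are two edges between the same two clusters, replacing them by `uv'` and `u'v` again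
gives a CT graph (`IsClustering.switch`).

Suppose that there is no circuit of length less than `g`, that `g ≤ 2k`, that `uv` lies on a circuit
of length `g`, and that the distance from `u` to `u'` is more than `2k`. Then the switched graph has
no circuit of length at most `g` through a new edge: a circuit through one new edge contains a short
walk from `u` to `u'`, and so does a circuit through both, unless it contains a trail from `v` to
`u` that closes up with `uv` to a circuit of `G` of length less than `g`. So no short circuit
appears, and fewer edges lie on a circuit of length `g`. Repeating this for `g = 1, …, 2k` removes
all circuits of length at most `2k` (`exists_circuitsGE_of_switch`).

A distant `u'` exists by counting. All degrees are at most `β ^ (k + 1)`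
(`IsClustering.degree_le`), so a ball of radius `2k` has fewer than
`β ^ ((k + 1) (2k + 1)) = β ^ (2k² + 3k + 1)` nodes (`ncard_ball_lt`). Clusters on level `l` are
given `β ^ (M - l)` nodes with `M = 2k² + 4k + 1`, and a cluster with children is on a level
`l ≤ k`, so it is not contained in the ball. There are at most `(k + 1) ^ l ≤ (β / 2) ^ l` clusters
on level `l`, so the total number of nodes is at most `2 β ^ M` (`IsTreelike.sum_pow_le`).
-/

/-! ### Switching edges to remove short circuits -/

namespace SimpleGraph

variable {V : Type*} {G : SimpleGraph V}

/-- A walk through the edge `ab` splits there, into parts that avoid a second passage if the walk is a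
trail; the alternative is the direction of the passage. -/
theorem Walk.exists_edges_eq_append_of_mem_edges {x y a b : V} (p : G.Walk x y)
    (h : s(a, b) ∈ p.edges) :
    (∃ (p₁ : G.Walk x a) (p₂ : G.Walk b y), p.edges = p₁.edges ++ s(a, b) :: p₂.edges) ∨
      ∃ (p₁ : G.Walk x b) (p₂ : G.Walk a y), p.edges = p₁.edges ++ s(a, b) :: p₂.edges := by
  induction p with
  | nil => simp at h
  | @cons x z y hxz p ih =>
    rw [Walk.edges_cons, List.mem_cons] at h
    rcases h with h | h
    · rw [Sym2.eq_iff] at h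
      rcases h with ⟨rfl, rfl⟩ | ⟨rfl, rfl⟩
      · exact Or.inl ⟨Walk.nil, p, by simp⟩
      · exact Or.inr ⟨Walk.nil, p, by simp [Sym2.eq_swap]⟩
    · rcases ih h with ⟨p₁, p₂, hp⟩ | ⟨p₁, p₂, hp⟩
      · exact Or.inl ⟨Walk.cons hxz p₁, p₂, by simp [hp]⟩
      · exact Or.inr ⟨Walk.cons hxz p₁, p₂, by simp [hp]⟩

/-- Opening a closed trail at one of its edges gives a trail between the ends of that edge. -/
theorem Walk.IsTrail.exists_open_at_edge {x a b : V} {c : G.Walk x x} (hc : c.IsTrail)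
    (h : s(a, b) ∈ c.edges) :
    ∃ q : G.Walk b a, q.IsTrail ∧ s(a, b) ∉ q.edges ∧ q.length + 1 = c.length := by
  have hn := hc.edges_nodup
  have hl := c.length_edges
  rcases c.exists_edges_eq_append_of_mem_edges h with ⟨p₁, p₂, hp⟩ | ⟨p₁, p₂, hp⟩
  · rw [hp] at hn hl
    refine ⟨p₂.append p₁, ⟨?_⟩, ?_, ?_⟩
    · rw [Walk.edges_append]; grind
    · rw [Walk.edges_append]; grind
    · simp at hl ⊢; omega
  · rw [hp] at hn hl
    refine ⟨(p₂.append p₁).reverse, ⟨?_⟩, ?_, ?_⟩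
    · rw [Walk.edges_reverse, List.nodup_reverse, Walk.edges_append]; grind
    · rw [Walk.edges_reverse, List.mem_reverse, Walk.edges_append]; grind
    · simp at hl ⊢; omega

/-- All circuits (nonempty closed trails) of `G` have length at least `g`. -/
def CircuitsGE (G : SimpleGraph V) (g : ℕ) : Prop :=
  ∀ ⦃x : V⦄ (c : G.Walk x x), c.IsTrail → 0 < c.length → g ≤ c.length

theorem CircuitsGE.le_egirth {g : ℕ} (h : G.CircuitsGE g) : (g : ℕ∞) ≤ G.egirth := by
  rw [SimpleGraph.le_egirth]
  intro a w hw
  exact_mod_cast h w hw.isCircuit.isTrail (by have := hw.three_le_length; omega)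

/-- The edges of `G` that lie on a closed trail of length at most `g`. -/
def shortCircuitEdges (G : SimpleGraph V) (g : ℕ) : Set (Sym2 V) :=
  {e | ∃ (x : V) (c : G.Walk x x), c.IsTrail ∧ c.length ≤ g ∧ e ∈ c.edges}

theorem CircuitsGE.succ {g : ℕ} (h : G.shortCircuitEdges g = ∅) : G.CircuitsGE (g + 1) := by
  intro x c hc hpos
  by_contra hlt
  cases c with
  | nil => simp at hpos
  | cons hxy p =>
    have : s(x, _) ∈ G.shortCircuitEdges g :=
      ⟨x, Walk.cons hxy p, hc, by omega, by rw [Walk.edges_cons]; exact List.mem_cons_self⟩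
    simp [h] at this

/-- The graph obtained from `G` by replacing the edges `uv` and `u'v'` by `uv'` and `u'v`. -/
def switch (G : SimpleGraph V) (u v u' v' : V) : SimpleGraph V where
  Adj a b := a ≠ b ∧ ((G.Adj a b ∧ s(a, b) ≠ s(u, v) ∧ s(a, b) ≠ s(u', v')) ∨
    s(a, b) = s(u, v') ∨ s(a, b) = s(u', v))
  symm := ⟨fun a b h => by
    rw [Sym2.eq_swap (a := b) (b := a), G.adj_comm b a]
    exact ⟨h.1.symm, h.2⟩⟩
  loopless := ⟨fun a h => h.1 rfl⟩

theorem switch_comm (u v u' v' : V) : G.switch u v u' v' = G.switch u' v' u v := by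
  ext a b
  simp only [switch]
  tauto

theorem mem_edgeSet_of_mem_switch {u v u' v' : V} {e : Sym2 V}
    (he : e ∈ (G.switch u v u' v').edgeSet) (h₁ : e ≠ s(u, v')) (h₂ : e ≠ s(u', v)) :
    e ∈ G.edgeSet ∧ e ≠ s(u, v) ∧ e ≠ s(u', v') := by
  induction e with
  | _ a b =>
    rw [mem_edgeSet] at he ⊢
    rcases he.2 with h | h | h
    · exact h
    · exact absurd h h₁
    · exact absurd h h₂

/-- If `u` and `u'` are far apart and `G` has no circuits of length less than `g`, switching creates
no circuit of length at most `g` through the new edge `uv'`. -/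
theorem not_mem_edges_of_isTrail_switch {u v u' v' : V} {n g : ℕ} (hgn : g ≤ n)
    (hG : G.CircuitsGE g) (huv : G.Adj u v) (hu'v' : G.Adj u' v')
    (hfar : ∀ p : G.Walk u u', n < p.length) {x : V} (c : (G.switch u v u' v').Walk x x)
    (hc : c.IsTrail) (hlen : c.length ≤ g) : s(u, v') ∉ c.edges := by
  intro hmem
  obtain ⟨q, hq, hqn, hql⟩ := hc.exists_open_at_edge hmem
  have hqe := fun e => q.edges_subset_edgeSet (e := e)
  by_cases h2 : s(u', v) ∈ q.edges
  · have hn := hq.edges_nodup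
    have hl := q.length_edges
    rcases q.exists_edges_eq_append_of_mem_edges h2 with ⟨p₁, p₂, hp⟩ | ⟨p₁, p₂, hp⟩
    · -- The part from `v` to `u` closes up, with the old edge `uv`, to a circuit shorter than `g`.
      rw [hp] at hn hl hqe hqn
      have he : ∀ e ∈ p₂.edges, e ∈ G.edgeSet ∧ e ≠ s(u, v) ∧ e ≠ s(u', v') := fun e he =>
        mem_edgeSet_of_mem_switch (hqe e (by simp [he])) (by grind) (by grind)
      have ht : (Walk.cons huv (p₂.transfer G fun e h => (he e h).1)).IsTrail := by
        refine ⟨?_⟩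
        rw [Walk.edges_cons, Walk.edges_transfer, List.nodup_cons]
        exact ⟨fun h => (he _ h).2.1 rfl, by grind⟩
      have := hG _ ht (by simp)
      simp at this hl
      omega
    · -- The part from `u'` to `u` is too short.
      rw [hp] at hn hl hqe hqn
      have he : ∀ e ∈ p₂.edges, e ∈ G.edgeSet := fun e he =>
        (mem_edgeSet_of_mem_switch (hqe e (by simp [he])) (by grind) (by grind)).1
      have := hfar (p₂.transfer G he).reverse
      simp at this hl
      omega
  · -- With `u'v'`, the part from `v'` to `u` gives a short walk between `u'` and `u`.
    have he : ∀ e ∈ q.edges, e ∈ G.edgeSet := fun e he =>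
      (mem_edgeSet_of_mem_switch (hqe e he) (by grind) (by grind)).1
    have := hfar (Walk.cons hu'v' (q.transfer G he)).reverse
    simp at this
    omega

/-- A short closed trail of the switched graph is a closed trail of `G` that avoids both removed
edges. -/
theorem edges_of_isTrail_switch {u v u' v' : V} {n g : ℕ} (hgn : g ≤ n)
    (hG : G.CircuitsGE g) (huv : G.Adj u v) (hu'v' : G.Adj u' v')
    (hfar : ∀ p : G.Walk u u', n < p.length) {x : V} (c : (G.switch u v u' v').Walk x x)
    (hc : c.IsTrail) (hlen : c.length ≤ g) :
    ∀ e ∈ c.edges, e ∈ G.edgeSet ∧ e ≠ s(u, v) ∧ e ≠ s(u', v') := by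
  have h₁ := not_mem_edges_of_isTrail_switch hgn hG huv hu'v' hfar c hc hlen
  have h₂ : s(u', v) ∉ c.edges := by
    have hfar' : ∀ p : G.Walk u' u, n < p.length := fun p => by simpa using hfar p.reverse
    have key := fun c' : (G.switch u' v' u v).Walk x x =>
      not_mem_edges_of_isTrail_switch hgn hG hu'v' huv hfar' c'
    rw [← switch_comm] at key
    exact key c hc hlen
  exact fun e he => mem_edgeSet_of_mem_switch (c.edges_subset_edgeSet he)
    (fun h => h₁ (h ▸ he)) (fun h => h₂ (h ▸ he))

theorem CircuitsGE.switch {u v u' v' : V} {n g : ℕ} (hgn : g ≤ n)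
    (hG : G.CircuitsGE g) (huv : G.Adj u v) (hu'v' : G.Adj u' v')
    (hfar : ∀ p : G.Walk u u', n < p.length) : (G.switch u v u' v').CircuitsGE g := by
  intro x c hc hpos
  by_contra hlt
  have he := edges_of_isTrail_switch hgn hG huv hu'v' hfar c hc (by omega)
  have := hG (c.transfer G fun e h => (he e h).1) ⟨by simpa using hc.edges_nodup⟩
    (by simpa using hpos)
  simp at this
  omega

theorem shortCircuitEdges_switch_ssubset {u v u' v' : V} {n g : ℕ} (hgn : g ≤ n)
    (hG : G.CircuitsGE g) (huv : G.Adj u v) (hu'v' : G.Adj u' v')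
    (hfar : ∀ p : G.Walk u u', n < p.length) (hmem : s(u, v) ∈ G.shortCircuitEdges g) :
    (G.switch u v u' v').shortCircuitEdges g ⊂ G.shortCircuitEdges g := by
  refine ⟨?_, fun h => ?_⟩
  · rintro e ⟨x, c, hc, hlen, hec⟩
    have he := edges_of_isTrail_switch hgn hG huv hu'v' hfar c hc hlen
    exact ⟨x, c.transfer G fun e h => (he e h).1, ⟨by simpa using hc.edges_nodup⟩,
      by simpa using hlen,
      by simpa using hec⟩
  · obtain ⟨x, c, hc, hlen, hec⟩ := h hmem
    exact (edges_of_isTrail_switch hgn hG huv hu'v' hfar c hc hlen _ hec).2.1 rfl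

/-- If a property of graphs can be kept while switching any given edge with an edge far from it,
then some graph with this property has no short circuits. -/
theorem exists_circuitsGE_of_switch [Finite V] (P : SimpleGraph V → Prop) (n : ℕ)
    (hP : ∀ G, P G → ∀ a b, G.Adj a b → ∃ u v u' v', s(a, b) = s(u, v) ∧ G.Adj u v ∧
      G.Adj u' v' ∧ (∀ p : G.Walk u u', n < p.length) ∧ P (G.switch u v u' v'))
    (hG : P G) : ∃ H, P H ∧ H.CircuitsGE (n + 1) := by
  suffices h : ∀ g ≤ n + 1, ∃ H, P H ∧ H.CircuitsGE g from h _ le_rfl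
  intro g
  induction g with
  | zero => exact fun _ => ⟨G, hG, fun _ _ _ _ => Nat.zero_le _⟩
  | succ g ih =>
    intro hgn
    obtain ⟨H, hH, hHg⟩ := ih (by omega)
    induction hm : (H.shortCircuitEdges g).ncard using Nat.strong_induction_on generalizing H with
    | _ m ihm =>
      rcases (H.shortCircuitEdges g).eq_empty_or_nonempty with h0 | ⟨e, he⟩
      · exact ⟨H, hH, CircuitsGE.succ h0⟩
      · have heH : e ∈ H.edgeSet := by
          obtain ⟨x, c, -, -, hec⟩ := he
          exact c.edges_subset_edgeSet hec
        induction e with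
        | _ a b =>
          obtain ⟨u, v, u', v', hab, huv, hu'v', hfar, hP'⟩ := hP H hH a b heH
          rw [hab] at he
          refine ihm _ ?_ _ hP' (hHg.switch (by omega) huv hu'v' hfar) rfl
          rw [← hm]
          exact Set.ncard_lt_ncard
            (shortCircuitEdges_switch_ssubset (by omega) hHg huv hu'v' hfar he)

/-- In a graph with degrees at most `d ≥ 2`, a ball of radius `n` has fewer than `d ^ (n + 1)`
vertices. -/
theorem ncard_ball_lt [Finite V] {d : ℕ} (hd : 2 ≤ d)
    (hdeg : ∀ w, {z | G.Adj w z}.ncard ≤ d) (n : ℕ) (u : V) :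
    {w | ∃ p : G.Walk u w, p.length ≤ n}.ncard < d ^ (n + 1) := by
  classical
  have := Fintype.ofFinite V
  induction n generalizing u with
  | zero =>
    have : {w | ∃ p : G.Walk u w, p.length ≤ 0} ⊆ {u} := by
      rintro w ⟨p, hp⟩
      exact (Walk.eq_of_length_eq_zero (by omega : p.length = 0)).symm
    calc _ ≤ ({u} : Set V).ncard := Set.ncard_le_ncard this
      _ < d ^ (0 + 1) := by simp; omega
  | succ n ih =>
    let B : V → Finset V := fun z => {w | ∃ p : G.Walk z w, p.length ≤ n}.toFinset
    have hB : ∀ z, (B z).card ≤ d ^ (n + 1) - 1 := fun z => by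
      have := ih z
      rw [Set.ncard_eq_toFinset_card'] at this
      exact Nat.le_sub_one_of_lt this
    have hsub : {w | ∃ p : G.Walk u w, p.length ≤ n + 1} ⊆
        ↑(insert u ({z | G.Adj u z}.toFinset.biUnion B)) := by
      rintro w ⟨p, hp⟩
      cases p with
      | nil => simp
      | @cons _ z _ h q =>
        simp only [Finset.coe_insert, Finset.coe_biUnion]
        refine Or.inr (Set.mem_biUnion (x := z) (by simpa using h) ?_)
        simp only [B, Set.coe_toFinset]
        exact ⟨q, by simpa using hp⟩
    have hN := hdeg u
    rw [Set.ncard_eq_toFinset_card'] at hN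
    have h1 : 1 ≤ d ^ (n + 1) := Nat.one_le_pow _ _ (by omega)
    calc _ ≤ (insert u ({z | G.Adj u z}.toFinset.biUnion B)).card := by
            rw [← Set.ncard_coe_finset]; exact Set.ncard_le_ncard hsub
      _ ≤ ({z | G.Adj u z}.toFinset.biUnion B).card + 1 := Finset.card_insert_le _ _
      _ ≤ {z | G.Adj u z}.toFinset.card * (d ^ (n + 1) - 1) + 1 := by
            gcongr; exact Finset.card_biUnion_le_card_mul _ _ _ fun z _ => hB z
      _ ≤ d * (d ^ (n + 1) - 1) + 1 := by gcongr
      _ < d ^ (n + 1 + 1) := by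
            obtain ⟨m, hm⟩ := Nat.exists_eq_add_of_le h1
            rw [pow_succ' d (n + 1), hm, Nat.add_sub_cancel_left, mul_add]
            omega

end SimpleGraph

namespace ClusterTree

open SimpleGraph

/-! ### The cluster tree skeleton -/

theorem mem_grow {k : ℕ} {S : Finset Cluster} {D : Cluster} :
    D ∈ grow k S ↔ D ∈ S ∨ (∃ C ∈ S, IsInternal S C ∧ D = k :: C) ∨
      ∃ C ∈ S, ¬ IsInternal S C ∧ ∃ p ≤ k, parentExponent C ≠ some p ∧ D = p :: C := by
  simp only [grow, Finset.mem_union, Finset.mem_image, Finset.mem_filter, Finset.mem_biUnion,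
    Finset.mem_range, Nat.lt_succ_iff, or_assoc, and_assoc, eq_comm (a := D)]

theorem cons_isInternal {S : Finset Cluster} {x : ℕ} {C : Cluster} (h : x :: C ∈ S) :
    IsInternal S C :=
  ⟨x :: C, h, by simp, rfl⟩

theorem isInternal_iff {S : Finset Cluster} {C : Cluster} :
    IsInternal S C ↔ ∃ x, x :: C ∈ S := by
  refine ⟨?_, fun ⟨x, hx⟩ => cons_isInternal hx⟩
  rintro ⟨_ | ⟨x, D⟩, hD, hne, rfl⟩
  · exact absurd rfl hne
  · exact ⟨x, hD⟩

/-- The properties of the skeleton that matter: it is closed under parents, the child exponents are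
at most `k`, the level is at most `k + 1`, and the outgoing labels of an internal cluster (to its
parent and to its children) have distinct exponents, all at most `k`. -/
structure IsTreelike (k : ℕ) (S : Finset Cluster) : Prop where
  parent_mem : ∀ {x C}, x :: C ∈ S → C ∈ S
  exponent_le : ∀ {x C}, x :: C ∈ S → x ≤ k
  length_le : ∀ {C}, C ∈ S → C.length ≤ k + 1
  parentExponent_le : ∀ {y x C}, y :: x :: C ∈ S → x + 1 ≤ k
  exponent_ne : ∀ {y x C}, y :: x :: C ∈ S → y ≠ x + 1

theorem IsTreelike.grow {k : ℕ} {S : Finset Cluster} (h : IsTreelike k S) :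
    IsTreelike (k + 1) (grow (k + 1) S) where
  parent_mem {x C} hx := by
    rcases mem_grow.1 hx with hx | ⟨D, hD, -, he⟩ | ⟨D, hD, -, p, -, -, he⟩
    · exact mem_grow.2 (Or.inl (h.parent_mem hx))
    all_goals
      obtain ⟨rfl, rfl⟩ := List.cons_eq_cons.1 he
      exact mem_grow.2 (Or.inl hD)
  exponent_le {x C} hx := by
    rcases mem_grow.1 hx with hx | ⟨D, hD, -, he⟩ | ⟨D, hD, -, p, hp, -, he⟩
    · exact (h.exponent_le hx).trans k.le_succ
    · exact (List.cons_eq_cons.1 he).1.le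
    · exact (List.cons_eq_cons.1 he).1.le.trans hp
  length_le {C} hC := by
    rcases mem_grow.1 hC with hC | ⟨D, hD, -, rfl⟩ | ⟨D, hD, -, p, hp, -, rfl⟩
    · exact (h.length_le hC).trans (k + 1).le_succ
    · simpa using h.length_le hD
    · simpa using h.length_le hD
  parentExponent_le {y x C} hy := by
    have key : x :: C ∈ S := by
      rcases mem_grow.1 hy with hy | ⟨D, hD, -, he⟩ | ⟨D, hD, -, p, hp, -, he⟩
      · exact h.parent_mem hy
      · exact (List.cons_eq_cons.1 he).2 ▸ hD
      · exact (List.cons_eq_cons.1 he).2 ▸ hD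
    simpa using h.exponent_le key
  exponent_ne {y x C} hy := by
    rcases mem_grow.1 hy with hy | ⟨D, hD, hi, he⟩ | ⟨D, hD, -, p, hp, hpe, he⟩
    · exact h.exponent_ne hy
    · obtain ⟨rfl, rfl⟩ := List.cons_eq_cons.1 he
      obtain ⟨z, hz⟩ := isInternal_iff.1 hi
      have := h.parentExponent_le hz
      omega
    · obtain ⟨rfl, rfl⟩ := List.cons_eq_cons.1 he
      simpa [parentExponent, eq_comm] using hpe

theorem isTreelike_skeleton {k : ℕ} (hk : 1 ≤ k) : IsTreelike k (skeleton k) := by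
  induction k, hk using Nat.le_induction with
  | base =>
    constructor <;> simp only [skeleton, Finset.mem_insert, Finset.mem_singleton]
    all_goals intros; simp_all <;> grind
  | succ k hk ih =>
    obtain ⟨k, rfl⟩ := Nat.exists_eq_add_of_le' hk
    exact ih.grow

/-- There are at most `(k + 1) ^ l` clusters on level `l`. -/
theorem IsTreelike.card_level_le {k : ℕ} {S : Finset Cluster} (h : IsTreelike k S) (l : ℕ) :
    (S.filter fun C => C.length = l).card ≤ (k + 1) ^ l := by
  induction l with
  | zero =>
    refine (Finset.card_le_card (t := {[]}) fun C hC => ?_).trans (by simp)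
    simpa using (Finset.mem_filter.1 hC).2
  | succ l ih =>
    have hsub : S.filter (fun C => C.length = l + 1) ⊆
        (Finset.range (k + 1) ×ˢ S.filter fun C => C.length = l).image fun p => p.1 :: p.2 := by
      intro C hC
      obtain ⟨hCS, hl⟩ := Finset.mem_filter.1 hC
      match C, hl with
      | x :: C, hl =>
        refine Finset.mem_image.2 ⟨(x, C), ?_, rfl⟩
        simpa [h.parent_mem hCS, Nat.lt_succ_iff, h.exponent_le hCS] using hl
    calc _ ≤ _ := Finset.card_le_card hsub
      _ ≤ _ := Finset.card_image_le
      _ = (k + 1) * (S.filter fun C => C.length = l).card := by simp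
      _ ≤ (k + 1) ^ (l + 1) := by rw [pow_succ']; gcongr

/-- With `β ^ (M - l)` nodes in each cluster on level `l`, the total is at most twice the number of
nodes in the root, as the levels decrease geometrically. -/
theorem IsTreelike.sum_pow_le {k β M : ℕ} {S : Finset Cluster} (h : IsTreelike k S)
    (hβ : 2 * (k + 1) ≤ β) (hM : k + 1 ≤ M) :
    ∑ C ∈ S, β ^ (M - C.length) ≤ 2 * β ^ M := by
  have hmaps : ∀ C ∈ S, C.length ∈ Finset.range (k + 2) := fun C hC => by
    have := h.length_le hC
    simp; omega
  rw [← Finset.sum_fiberwise_of_maps_to hmaps]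
  calc _ ≤ ∑ l ∈ Finset.range (k + 2), β ^ M / 2 ^ l := Finset.sum_le_sum fun l hl => ?_
    _ ≤ β ^ M * 2 / (2 - 1) := Nat.geom_sum_le le_rfl _ _
    _ = 2 * β ^ M := by simp [mul_comm]
  have hl' : l ≤ M := by simp at hl; omega
  rw [Nat.le_div_iff_mul_le (by positivity)]
  calc (∑ C ∈ S with C.length = l, β ^ (M - C.length)) * 2 ^ l
      = (S.filter fun C => C.length = l).card * β ^ (M - l) * 2 ^ l := by
        rw [Finset.sum_congr rfl fun C hC => by rw [(Finset.mem_filter.1 hC).2],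
          Finset.sum_const, smul_eq_mul]
    _ ≤ (k + 1) ^ l * β ^ (M - l) * 2 ^ l := by gcongr; exact h.card_level_le l
    _ = (2 * (k + 1)) ^ l * β ^ (M - l) := by rw [mul_pow]; ring
    _ ≤ β ^ l * β ^ (M - l) := by gcongr
    _ = β ^ M := by rw [← pow_add, Nat.add_sub_cancel' hl']

/-! ### Switching and degrees in CT graphs -/

section Clustering

variable {V : Type*} {k β : ℕ} {G : SimpleGraph V} {c : V → Cluster}

/-- A clustering passes to a graph with edges only between adjacent clusters, each neighborhood of
which is carried to the corresponding neighborhood in `G` by a permutation preserving clusters. -/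
theorem IsClustering.of_perm (h : IsClustering k β G c) {H : SimpleGraph V}
    (hadj : ∀ v w, H.Adj v w → ∃ x, c w = x :: c v ∨ c v = x :: c w)
    (hperm : ∀ w, ∃ σ : Equiv.Perm V, (∀ z, c (σ z) = c z) ∧ ∀ z, H.Adj w z ↔ G.Adj w (σ z)) :
    IsClustering k β H c := by
  have hcard : ∀ w D, {z | H.Adj w z ∧ c z = D}.ncard = {z | G.Adj w z ∧ c z = D}.ncard := by
    intro w D
    obtain ⟨σ, hσ, hHG⟩ := hperm w
    have : {z | G.Adj w z ∧ c z = D} = σ '' {z | H.Adj w z ∧ c z = D} := by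
      ext z
      simp only [Set.mem_ofPred_eq, Set.mem_image_equiv]
      rw [hHG, Equiv.apply_symm_apply, ← hσ (σ.symm z), Equiv.apply_symm_apply]
    rw [this, Set.ncard_image_of_injective _ σ.injective]
  exact ⟨h.mem, h.nonempty, hadj, fun x C hx v hv => (hcard v _).trans (h.down x C hx v hv),
    fun x C hx w hw => (hcard w _).trans (h.up x C hx w hw)⟩

theorem IsClustering.switch (h : IsClustering k β G c) {u v u' v' : V} {x : ℕ}
    (hv : c v = x :: c u) (hu' : c u' = c u) (hv' : c v' = c v) (huv : G.Adj u v)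
    (hu'v' : G.Adj u' v') (huu' : u ≠ u') (h₁ : ¬ G.Adj u v') (h₂ : ¬ G.Adj u' v) :
    IsClustering k β (G.switch u v u' v') c := by
  classical
  have hvv' : v ≠ v' := fun e => h₁ (e ▸ huv)
  have hne : ∀ {a b}, c b = x :: c a → a ≠ b := by
    rintro a b hab rfl
    simpa using congrArg List.length hab
  have huv_ne : u ≠ v := hne hv
  have huv'_ne : u ≠ v' := hne (hv'.trans hv)
  have hu'v_ne : u' ≠ v := hne (by rw [hv, hu'])
  have hu'v'_ne : u' ≠ v' := hne (by rw [hv', hv, hu'])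
  refine h.of_perm ?_ fun w => ?_
  · rintro a b ⟨-, ⟨hab, -⟩ | hab | hab⟩
    · exact h.adj a b hab
    all_goals
      rw [Sym2.eq_iff] at hab
      rcases hab with ⟨rfl, rfl⟩ | ⟨rfl, rfl⟩
      · exact ⟨x, Or.inl (by simp_all)⟩
      · exact ⟨x, Or.inr (by simp_all)⟩
  · have hswap : ∀ {a b}, c a = c b → ∀ z, c (Equiv.swap a b z) = c z := by
      intro a b hab z
      rw [Equiv.swap_apply_def]
      split_ifs with ha hb
      · rw [ha, hab]
      · rw [hb, hab]
      · rfl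
    -- The neighbors of `u` and `u'` change by exchanging `v` and `v'`, and those of `v` and `v'` by
    -- exchanging `u` and `u'`.
    by_cases hwu : w = u ∨ w = u'
    · refine ⟨Equiv.swap v v', hswap hv'.symm, fun z => ?_⟩
      rw [Equiv.swap_apply_def]
      simp only [SimpleGraph.switch, Sym2.eq_iff]
      have := G.ne_of_adj (a := w) (b := z)
      rcases hwu with rfl | rfl <;> split_ifs <;> grind
    · by_cases hwv : w = v ∨ w = v'
      · refine ⟨Equiv.swap u u', hswap hu'.symm, fun z => ?_⟩
        rw [Equiv.swap_apply_def]
        simp only [SimpleGraph.switch, Sym2.eq_iff]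
        have := G.ne_of_adj (a := w) (b := z)
        rcases hwv with rfl | rfl <;> split_ifs <;> grind [SimpleGraph.adj_comm]
      · refine ⟨1, fun z => rfl, fun z => ?_⟩
        simp only [SimpleGraph.switch, Sym2.eq_iff, Equiv.Perm.one_apply]
        have := G.ne_of_adj (a := w) (b := z)
        grind

/-- The edges at a node of an internal cluster have labels `β ^ y` with distinct `y ≤ k`, and those
at a node of a leaf have a single label, so that all degrees are at most `β ^ (k + 1)`. -/
theorem IsClustering.degree_le [Finite V] (h : IsClustering k β G c) (hk : 1 ≤ k) (hβ : 2 ≤ β)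
    (w : V) : {z | G.Adj w z}.ncard ≤ β ^ (k + 1) := by
  classical
  have := Fintype.ofFinite V
  have hT := isTreelike_skeleton hk
  by_cases hi : ∃ y, y :: c w ∈ skeleton k
  · obtain ⟨y₀, hy₀⟩ := hi
    let N : ℕ → Finset V := fun y =>
      {z | G.Adj w z ∧ (c z = y :: c w ∨ ∃ x, y = x + 1 ∧ c w = x :: c z)}.toFinset
    have hN : ∀ y, (N y).card ≤ β ^ y := by
      intro y
      rw [← Set.ncard_eq_toFinset_card']
      by_cases hp : ∃ x C, y = x + 1 ∧ c w = x :: C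
      · obtain ⟨x, C, rfl, hC⟩ := hp
        rw [← h.up x C (hC ▸ h.mem w) w hC]
        refine Set.ncard_le_ncard fun z hz => ⟨hz.1, ?_⟩
        rcases hz.2 with hz' | ⟨x', hx', hz'⟩
        · have := h.mem z
          rw [hz', hC] at this
          exact absurd rfl (hT.exponent_ne this)
        · exact (List.cons_eq_cons.1 (hz'.symm.trans hC)).2
      · have hsub : {z | G.Adj w z ∧ (c z = y :: c w ∨ ∃ x, y = x + 1 ∧ c w = x :: c z)} ⊆
            {z | G.Adj w z ∧ c z = y :: c w} := fun z hz =>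
          ⟨hz.1, hz.2.resolve_right fun ⟨x, hx, hz'⟩ => hp ⟨x, _, hx, hz'⟩⟩
        refine (Set.ncard_le_ncard hsub).trans ?_
        by_cases hy : y :: c w ∈ skeleton k
        · exact (h.down y _ hy w rfl).le
        · have : {z | G.Adj w z ∧ c z = y :: c w} = ∅ := by
            ext z
            simp only [Set.mem_ofPred_eq, Set.mem_empty_iff_false, iff_false]
            exact fun hz => hy (hz.2 ▸ h.mem z)
          simp [this]
    have hsub : {z | G.Adj w z} ⊆ ↑((Finset.range (k + 1)).biUnion N) := by
      intro z hz
      obtain ⟨x, hx | hx⟩ := h.adj w z hz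
      · have := hT.exponent_le (hx ▸ h.mem z)
        simp only [Finset.coe_biUnion]
        exact Set.mem_biUnion (x := x) (by simp; omega) (by simpa [N] using ⟨hz, Or.inl hx⟩)
      · have := hT.parentExponent_le (hx ▸ hy₀)
        simp only [Finset.coe_biUnion]
        exact Set.mem_biUnion (x := x + 1) (by simp; omega)
          (by simpa [N] using ⟨hz, Or.inr hx⟩)
    calc _ ≤ ((Finset.range (k + 1)).biUnion N).card := by
            rw [← Set.ncard_coe_finset]; exact Set.ncard_le_ncard hsub
      _ ≤ ∑ y ∈ Finset.range (k + 1), (N y).card := Finset.card_biUnion_le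
      _ ≤ ∑ y ∈ Finset.range (k + 1), β ^ y := Finset.sum_le_sum fun y _ => hN y
      _ ≤ β ^ (k + 1) := (Nat.geomSum_lt hβ fun y hy => Finset.mem_range.1 hy).le
  · have hup : ∀ z, G.Adj w z → ∃ x, c w = x :: c z := fun z hz => by
      obtain ⟨x, hx | hx⟩ := h.adj w z hz
      · exact absurd ⟨x, hx ▸ h.mem z⟩ hi
      · exact ⟨x, hx⟩
    rcases hw : c w with _ | ⟨x, C⟩
    · have : {z | G.Adj w z} = ∅ := by
        ext z
        simp only [Set.mem_ofPred_eq, Set.mem_empty_iff_false, iff_false]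
        intro hz
        obtain ⟨x, hx⟩ := hup z hz
        simp [hw] at hx
      simp [this]
    · have hx := hw ▸ h.mem w
      have hsub : {z | G.Adj w z} ⊆ {z | G.Adj w z ∧ c z = C} := fun z hz => by
        obtain ⟨x', hx'⟩ := hup z hz
        exact ⟨hz, (List.cons_eq_cons.1 (hx'.symm.trans hw)).2⟩
      calc _ ≤ _ := Set.ncard_le_ncard hsub
        _ = β ^ (x + 1) := h.up x C hx w hw
        _ ≤ β ^ (k + 1) := Nat.pow_le_pow_right (by omega)
            (Nat.succ_le_succ (hT.exponent_le hx))

/-- If the clusters with children are larger than the balls of radius `2k`, every edge can be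
switched with a distant edge between the same two clusters. -/
theorem IsClustering.exists_switch [Finite V] (h : IsClustering k β G c) (hk : 1 ≤ k)
    (hβ : 2 ≤ β) (hlarge : ∀ C ∈ skeleton k, C.length ≤ k →
      β ^ (2 * k ^ 2 + 3 * k + 1) ≤ {z | c z = C}.ncard) {a b : V} (hab : G.Adj a b) :
    ∃ u v u' v', s(a, b) = s(u, v) ∧ G.Adj u v ∧ G.Adj u' v' ∧
      (∀ p : G.Walk u u', 2 * k < p.length) ∧ IsClustering k β (G.switch u v u' v') c := by
  have hT := isTreelike_skeleton hk
  obtain ⟨u, v, huv, hs, x, hx⟩ : ∃ u v, G.Adj u v ∧ s(a, b) = s(u, v) ∧ ∃ x, c v = x :: c u := by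
    obtain ⟨x, hx | hx⟩ := h.adj a b hab
    · exact ⟨a, b, hab, rfl, x, hx⟩
    · exact ⟨b, a, hab.symm, Sym2.eq_swap, x, hx⟩
  have hmem : x :: c u ∈ skeleton k := hx ▸ h.mem v
  have hball : {w | ∃ p : G.Walk u w, p.length ≤ 2 * k}.ncard < {z | c z = c u}.ncard := by
    refine lt_of_lt_of_le ?_
      (hlarge _ (h.mem u) (by simpa using hT.length_le hmem))
    have := ncard_ball_lt (Nat.le_self_pow (by omega) β |> hβ.trans) (h.degree_le hk hβ) (2 * k) u
    rw [← pow_mul, show (k + 1) * (2 * k + 1) = 2 * k ^ 2 + 3 * k + 1 by ring] at this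
    exact this
  obtain ⟨u', hu', hfar⟩ := Set.exists_mem_notMem_of_ncard_lt_ncard hball
  replace hfar : ∀ p : G.Walk u u', 2 * k < p.length := fun p => by
    by_contra hp
    exact hfar ⟨p, by omega⟩
  obtain ⟨v', hu'v', hv'⟩ : {z | G.Adj u' z ∧ c z = x :: c u}.Nonempty := by
    apply Set.nonempty_of_ncard_ne_zero
    rw [h.down x (c u) hmem u' hu']
    positivity
  refine ⟨u, v, u', v', hs, huv, hu'v', hfar,
    h.switch hx hu' (hv'.trans hx.symm) huv hu'v' ?_ ?_ ?_⟩
  · rintro rfl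
    simpa using hfar Walk.nil
  · intro hadj
    have := hfar (Walk.cons hadj hu'v'.symm.toWalk)
    simp at this
    omega
  · intro hadj
    have := hfar (Walk.cons huv hadj.symm.toWalk)
    simp at this
    omega

end Clustering

/-! ### A CT graph without girth condition -/

/-- The nodes of the blockwise complete CT graph: a cluster `C` consists of the nodes `⟨C, i⟩` with
`i < β ^ (M - C.length)`. -/
abbrev BlockNode (k β M : ℕ) : Type :=
  {p : Σ _ : Cluster, ℕ // p ∈ (skeleton k).sigma fun C => Finset.range (β ^ (M - C.length))}

/-- The edges from a cluster `C` to its child `x :: C` in the blockwise complete CT graph: `C` is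
cut into intervals of length `β ^ (x + 1)`, `x :: C` into equally many intervals of length `β ^ x`,
and corresponding intervals are joined completely. -/
def blockGraph (k β M : ℕ) : SimpleGraph (BlockNode k β M) where
  Adj v w := ∃ x,
    (w.1.1 = x :: v.1.1 ∧ v.1.2 / β ^ (x + 1) = w.1.2 / β ^ x) ∨
    (v.1.1 = x :: w.1.1 ∧ w.1.2 / β ^ (x + 1) = v.1.2 / β ^ x)
  symm := ⟨fun _ _ ⟨x, h⟩ => ⟨x, h.symm⟩⟩
  loopless := ⟨fun v ⟨x, h⟩ => by
    rcases h with h | h <;> simpa using congrArg List.length h.1⟩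

theorem BlockNode.mem {k β M : ℕ} (v : BlockNode k β M) :
    v.1.1 ∈ skeleton k ∧ v.1.2 < β ^ (M - v.1.1.length) := by
  simpa using Finset.mem_sigma.1 v.2

theorem BlockNode.ncard_interval {k β M : ℕ} (hβ : 0 < β) {D : Cluster} (hD : D ∈ skeleton k)
    {a b t : ℕ} (hab : a + b = M - D.length) (ht : t < β ^ b) :
    {w : BlockNode k β M | w.1.1 = D ∧ w.1.2 / β ^ a = t}.ncard = β ^ a := by
  have hpos : 0 < β ^ a := by positivity
  have hiff : ∀ j, j / β ^ a = t ↔ j ∈ Finset.Ico (t * β ^ a) ((t + 1) * β ^ a) := fun j => by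
    rw [Finset.mem_Ico, ← Nat.le_div_iff_mul_le hpos, ← Nat.div_lt_iff_lt_mul hpos]
    omega
  have hcard : ((Finset.Ico (t * β ^ a) ((t + 1) * β ^ a) : Finset ℕ) : Set ℕ).ncard = β ^ a := by
    rw [Set.ncard_coe_finset, Nat.card_Ico, add_mul, one_mul, Nat.add_sub_cancel_left]
  refine Eq.trans (Set.ncard_congr (fun w _ => w.1.2) (fun w hw => (hiff _).1 hw.2) ?_ ?_) hcard
  · rintro ⟨⟨C, i⟩, hC⟩ ⟨⟨C', i'⟩, hC'⟩ ⟨h₁, -⟩ ⟨h₂, -⟩ h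
    simp only at h₁ h₂ h
    subst h₁ h₂ h
    rfl
  · intro j hj
    refine ⟨⟨⟨D, j⟩, ?_⟩, ⟨rfl, (hiff j).2 hj⟩, rfl⟩
    rw [Finset.mem_sigma, Finset.mem_range, ← hab, add_comm, pow_add]
    refine ⟨hD, (Finset.mem_Ico.1 hj).2.trans_le ?_⟩
    gcongr
    exact ht

theorem isClustering_blockGraph {k β M : ℕ} (hk : 1 ≤ k) (hβ : 0 < β) (hM : 2 * k + 1 ≤ M) :
    IsClustering k β (blockGraph k β M) fun v => v.1.1 := by
  have hT := isTreelike_skeleton hk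
  have hexp : ∀ {x : ℕ} {C : Cluster}, x :: C ∈ skeleton k →
      x + (M - C.length - 1 - x) = M - (x :: C).length ∧
      (x + 1) + (M - C.length - 1 - x) = M - C.length := by
    intro x C hx
    have h₁ := hT.exponent_le hx
    have h₂ := hT.length_le hx
    rw [List.length_cons] at h₂ ⊢
    omega
  have hdiv : ∀ {i a b : ℕ} {m : ℕ}, a + b = m → i < β ^ m → i / β ^ a < β ^ b := by
    intro i a b m hab hi
    apply Nat.div_lt_of_lt_mul
    rwa [← pow_add, hab]
  refine ⟨fun v => v.mem.1, fun C hC => ⟨⟨⟨C, 0⟩, ?_⟩, rfl⟩, ?_, ?_, ?_⟩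
  · simp [hC, hβ]
  · rintro v w ⟨x, h | h⟩
    · exact ⟨x, Or.inl h.1⟩
    · exact ⟨x, Or.inr h.1⟩
  · intro x C hx v hv
    have hlt := v.mem.2
    rw [hv] at hlt
    rw [← BlockNode.ncard_interval hβ hx (hexp hx).1 (hdiv (hexp hx).2 hlt)]
    congr 1
    ext w
    constructor
    · rintro ⟨⟨y, h | h⟩, hw⟩
      · obtain ⟨rfl, -⟩ := List.cons_eq_cons.1 (h.1.symm.trans hw)
        exact ⟨hw, h.2.symm⟩
      · have := congrArg List.length h.1
        simp [hw, hv] at this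
        omega
    · rintro ⟨hw, h⟩
      exact ⟨⟨x, Or.inl ⟨by rw [hw, hv], h.symm⟩⟩, hw⟩
  · intro x C hx w hw
    have hlt := w.mem.2
    rw [hw] at hlt
    rw [← BlockNode.ncard_interval hβ (hT.parent_mem hx) (hexp hx).2 (hdiv (hexp hx).1 hlt)]
    congr 1
    ext v
    constructor
    · rintro ⟨⟨y, h | h⟩, hv⟩
      · have := congrArg List.length h.1
        simp [hw, hv] at this
        omega
      · obtain ⟨rfl, -⟩ := List.cons_eq_cons.1 (h.1.symm.trans hw)
        exact ⟨hv, h.2⟩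
    · rintro ⟨hv, h⟩
      exact ⟨⟨x, Or.inr ⟨by rw [hw, hv], h⟩⟩, hv⟩

end ClusterTree

/-! ### CT graphs of large girth -/

theorem mainTheorem3 :
    ∃ A : ℕ, ∀ k : ℕ, 1 ≤ k → ∀ β : ℕ, 2 * (k + 1) ≤ β →
      ∃ (V : Type) (_ : Fintype V) (G : SimpleGraph V),
        ClusterTree.IsCTGraph k β G ∧
        ((2 * k + 1 : ℕ) : ℕ∞) ≤ G.egirth ∧
        Fintype.card V ≤ A * β ^ (2 * k ^ 2 + 4 * k + 1) := by
  refine ⟨2, fun k hk β hβ => ?_⟩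
  set M := 2 * k ^ 2 + 4 * k + 1 with hM
  have hlarge : ∀ C ∈ ClusterTree.skeleton k, C.length ≤ k → β ^ (2 * k ^ 2 + 3 * k + 1) ≤
      {z : ClusterTree.BlockNode k β M | z.1.1 = C}.ncard := by
    intro C hC hlen
    have := ClusterTree.BlockNode.ncard_interval (M := M) (by omega : 0 < β) hC
      (a := M - C.length) (b := 0) (t := 0) rfl (by simp)
    -- Here the choice of `M` is used: `M - k = (k + 1) (2k + 1)`.
    calc _ ≤ β ^ (M - C.length) := Nat.pow_le_pow_right (by omega) (by omega)
      _ ≤ _ := this ▸ Set.ncard_le_ncard fun z hz => hz.1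
  obtain ⟨H, hH, hgirth⟩ := SimpleGraph.exists_circuitsGE_of_switch
    (fun G => ClusterTree.IsClustering k β G fun v : ClusterTree.BlockNode k β M => v.1.1) (2 * k)
    (fun G hG a b hab => hG.exists_switch hk (by omega) hlarge hab)
    (ClusterTree.isClustering_blockGraph hk (by omega) (by rw [hM]; nlinarith))
  refine ⟨ClusterTree.BlockNode k β M, inferInstance, H, ⟨_, hH⟩, hgirth.le_egirth, ?_⟩
  rw [Fintype.card_coe, Finset.card_sigma]
  simpa using (ClusterTree.isTreelike_skeleton hk).sum_pow_le hβ (M := M) (by rw [hM]; nlinarith)
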